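/- Let $K$ be a field and $f\in K[t]$ a polynomial. The generalized Heisenberg algebra $\mathcal H(f)$ is the unital associative $K$-algebra with generators $x,y,t$ and defining relations $tx=xf(t)$, $yt=f(t)y$, $yx-xy=f(t)-t$. A ring $A$ is a skew PBW extension of a subring $R$ (with the same identity) in elements $x_1,\dots,x_n\in A$ ($n\ge 0$) if: $A$ is a free left $R$-module with basis the standard monomials $x_1^{\alpha_1}\cdots x_n^{\alpha_n}$, $\alpha\in\mathbb N^n$; for all $i$ and all $r\in R\setminus\{0\}$ there is $c_{i,r}\in R\setminus\{0\}$ with $x_ir-c_{i,r}x_i\in R$; and for all $i,j$ there is $d_{i,j}\in R\setminus\{0\}$ with $x_jx_i-d_{i,j}x_ix_j\in R+Rx_1+\cdots+Rx_n$. Then there are unique injective endomorphisms $\sigma_i$ of $R$ and $\sigma_i$-derivations $\delta_i$ of $R$ with $x_ir=\sigma_i(r)x_i+\delta_i(r)$ for all $r\in R$. The extension is bijective if every $\sigma_i$ is bijective and $d_{i,j}$ is invertible in $R$ for all $i<j$; it is of endomorphism type if every $\delta_i$ is zero. $A$ is a (bijective, endomorphism type) skew PBW extension of $R$ if this holds for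 some $n$ and some $x_1,\dots,x_n\in A$. **Theorem.** The following are equivalent, where $K$ and $K[t]$ are mapped to $\mathcal H(f)$ canonically: (i) $\mathcal H(f)$ is a bijective skew PBW extension of endomorphism type of $K[t]$ (in particular, $K[t]\to\mathcal H(f)$ is injective); (ii) $\mathcal H(f)$ is a skew PBW extension of $K$; (iii) $\mathcal H(f)$ is left noetherian or right noetherian; (iii') $\mathcal H(f)$ is both left and right noetherian; (iv) $\deg f=1$. -/

import Mathlib

section SkewPBW

variable {R A : Type*} [Ring R] [Ring A]

/-- The standard monomial `x₁ ^ α₁ * ⋯ * xₙ ^ αₙ` (in this order). -/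
def stdMonomial {n : ℕ} (x : Fin n → A) (α : Fin n → ℕ) : A :=
  (List.ofFn fun i => x i ^ α i).prod

/-- `x_j x_i - d x_i x_j ∈ R + R x₁ + ⋯ + R xₙ`, where `R` is viewed inside `A` through `ι`. -/
def CommutesUpTo (ι : R →+* A) {n : ℕ} (x : Fin n → A) (i j : Fin n) (d : R) : Prop :=
  ∃ (r₀ : R) (r : Fin n → R),
    x j * x i - ι d * (x i * x j) = ι r₀ + ∑ k, ι (r k) * x k

/-- `A` is a skew PBW extension of `R` in the variables `x₁, …, xₙ`; the subring `R ⊆ A` is given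
by the injective ring homomorphism `ι : R → A`. -/
structure IsSkewPBWExtension (ι : R →+* A) {n : ℕ} (x : Fin n → A) : Prop where
  /-- `R` is a subring of `A` (with the same identity). -/
  injective : Function.Injective ι
  /-- `A` is a free left `R`-module with basis the standard monomials: each element is
  `∑ c_α x^α` for exactly one finitely supported family `c` of coefficients. -/
  basis : Function.Bijective fun c : (Fin n → ℕ) →₀ R =>
    c.sum fun α r => ι r * stdMonomial x α
  /-- `x_i r - c_{i,r} x_i ∈ R` with `c_{i,r} ≠ 0`, for all `r ≠ 0`. -/
  coeff : ∀ (i : Fin n) (r : R), r ≠ 0 →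
    ∃ c : R, c ≠ 0 ∧ ∃ s : R, x i * ι r - ι c * x i = ι s
  /-- `x_j x_i - d_{i,j} x_i x_j ∈ R + R x₁ + ⋯ + R xₙ` with `d_{i,j} ≠ 0`. -/
  comm : ∀ i j : Fin n, ∃ d : R, d ≠ 0 ∧ CommutesUpTo ι x i j d

/-- `σ i` is an injective endomorphism of `R`, `δ i` is a `σ i`-derivation of `R`, and
`x_i r = σ_i(r) x_i + δ_i(r)`. In a skew PBW extension such `σ` and `δ` are unique, because `1`
and `x_i` are left linearly independent over `R`. -/
structure IsSkewPBWAction (ι : R →+* A) {n : ℕ} (x : Fin n → A)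
    (σ : Fin n → R →+* R) (δ : Fin n → R →+ R) : Prop where
  injective : ∀ i, Function.Injective (σ i)
  leibniz : ∀ i r s, δ i (r * s) = σ i r * δ i s + δ i r * s
  mul_eq : ∀ i r, x i * ι r = ι (σ i r) * x i + ι (δ i r)

/-- The skew PBW extension is bijective: all `σ_i` are bijective and `d_{i,j}` is invertible for
`i < j`. (For `i < j` the coefficient `d_{i,j}` is unique, since `x_i x_j` is a standard
monomial.) -/
def IsBijectiveSkewPBW (ι : R →+* A) {n : ℕ} (x : Fin n → A) : Prop :=
  (∃ σ δ, IsSkewPBWAction ι x σ δ ∧ ∀ i, Function.Bijective (σ i)) ∧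
    ∀ i j : Fin n, i < j → ∃ d : R, IsUnit d ∧ CommutesUpTo ι x i j d

/-- The skew PBW extension is of endomorphism type: all `δ_i` vanish. -/
def IsEndomorphismTypeSkewPBW (ι : R →+* A) {n : ℕ} (x : Fin n → A) : Prop :=
  ∃ σ δ, IsSkewPBWAction ι x σ δ ∧ ∀ i, δ i = 0

end SkewPBW

/-- The generators of a generalized Heisenberg algebra. -/
inductive GenHeisenbergVar : Type
  | x
  | y
  | t

namespace GenHeisenberg

open GenHeisenbergVar

/-- The defining relations `tx = xf`, `yt = fy`, `yx - xy = f - t`. -/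
inductive Relation {K : Type*} [Field K] (f : Polynomial K) :
    FreeAlgebra K GenHeisenbergVar → FreeAlgebra K GenHeisenbergVar → Prop
  | tx : Relation f (FreeAlgebra.ι K t * FreeAlgebra.ι K x)
      (FreeAlgebra.ι K x * Polynomial.aeval (FreeAlgebra.ι K t) f)
  | yt : Relation f (FreeAlgebra.ι K y * FreeAlgebra.ι K t)
      (Polynomial.aeval (FreeAlgebra.ι K t) f * FreeAlgebra.ι K y)
  | yx : Relation f
      (FreeAlgebra.ι K y * FreeAlgebra.ι K x - FreeAlgebra.ι K x * FreeAlgebra.ι K y)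
      (Polynomial.aeval (FreeAlgebra.ι K t) f - FreeAlgebra.ι K t)

end GenHeisenberg

/-- The generalized Heisenberg algebra `H(f)`. -/
abbrev GenHeisenberg {K : Type*} [Field K] (f : Polynomial K) : Type _ :=
  RingQuot (GenHeisenberg.Relation f)

/-- The image in `H(f)` of a generator. -/
noncomputable def GenHeisenberg.gen {K : Type*} [Field K] (f : Polynomial K)
    (v : GenHeisenbergVar) : GenHeisenberg f :=
  RingQuot.mkAlgHom K (GenHeisenberg.Relation f) (FreeAlgebra.ι K v)

/-- The canonical map `K[t] → H(f)`, sending the indeterminate to the generator `t`. -/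
noncomputable def GenHeisenberg.ofPoly {K : Type*} [Field K] (f : Polynomial K) :
    Polynomial K →+* GenHeisenberg f :=
  (Polynomial.aeval (GenHeisenberg.gen f GenHeisenbergVar.t)).toRingHom

/-! For every `f`, the elements `x ^ i * g(t) * y ^ j` span (`mem_of_normalOrdered`) and are
separated by the representation `rep f 1` (`rep_normalOrdered`), so `H(f)` is the direct sum of the
spaces `x ^ i K[t] y ^ j`.

If `deg f = 1`, composition with `f` is an automorphism of `K[t]`; coefficients can then be moved
across `x`, giving an extension of `K[t]` in `x, y`, and the relations become quadratic, giving one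
of `K` in `x, t, y`. A skew PBW extension of a field is left noetherian by comparing leading
exponents and using Dickson's lemma (`isNoetherianRing_of_quasiCommuting`); the anti-automorphism
exchanging `x` and `y` gives the right side.

If `deg f ≠ 1`, the left ideals generated by the `(f - t) * y ^ k` with `k < n` increase strictly,
because `f - t` divides `(f - t) ∘ f` but not conversely (`natDegree_eq_one_of_isNoetherianRing`).
Nor can (i) hold: each variable `z` satisfies `z t = s(t) z` with `s` of degree 1, and degrees force
`z` to preserve the `x`-free part of the `K[t]`-linear representation `rep f 0`. Then all of `H(f)`
preserves it, which is false for `x` (`natDegree_eq_one_of_isSkewPBWExtension`). -/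

/-! ### A noetherian criterion for algebras spanned by quasi-commuting monomials -/

namespace MonomialOrder

open scoped MonomialOrder

variable {K A σ : Type*} [Field K] [Ring A] [Algebra K A] (o : MonomialOrder σ)
  (m : (σ →₀ ℕ) → A)

/-- The span of the monomials `m β` with `β ≺ α`. -/
def spanBelow (K : Type*) [Field K] [Algebra K A] (α : σ →₀ ℕ) : Submodule K A :=
  Submodule.span K (m '' {β | β ≺[o] α})

/-- The exponents `α` for which some element of the left ideal `I` is `m α` up to smaller terms. -/
def leadingExponents (K : Type*) [Field K] [Algebra K A] (I : Ideal A) : Set (σ →₀ ℕ) :=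
  {α | ∃ a ∈ I, a - m α ∈ o.spanBelow m K α}

variable {o m}

theorem spanBelow_mono {α β : σ →₀ ℕ} (h : α ≼[o] β) : o.spanBelow m K α ≤ o.spanBelow m K β :=
  Submodule.span_mono (Set.image_mono fun _ hγ => lt_of_lt_of_le hγ h)

theorem mem_spanBelow {α β : σ →₀ ℕ} (h : α ≺[o] β) : m α ∈ o.spanBelow m K β :=
  Submodule.subset_span ⟨α, h, rfl⟩

theorem leadingExponents_mono {I J : Ideal A} (h : I ≤ J) :
    o.leadingExponents m K I ⊆ o.leadingExponents m K J :=
  fun _ ⟨a, ha, hα⟩ => ⟨a, h ha, hα⟩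

theorem mul_mem_spanBelow
    (hm : ∀ α β, ∃ q : K, q ≠ 0 ∧ m α * m β - q • m (α + β) ∈ o.spanBelow m K (α + β))
    (α β : σ →₀ ℕ) {b : A} (hb : b ∈ o.spanBelow m K β) :
    m α * b ∈ o.spanBelow m K (α + β) := by
  have : o.spanBelow m K β ≤ (o.spanBelow m K (α + β)).comap (LinearMap.mulLeft K (m α)) := by
    refine Submodule.span_le.2 ?_
    rintro _ ⟨γ, hγ, rfl⟩
    have hlt : (α + γ) ≺[o] (α + β) := by simpa using hγ
    obtain ⟨q, -, hq⟩ := hm α γ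
    simpa using add_mem (spanBelow_mono hlt.le hq)
      (Submodule.smul_mem _ q (mem_spanBelow (K := K) (m := m) hlt))
  exact this hb

/-- Left multiplication by `m α` shifts leading exponents by `α`, and the factor `q` it introduces
is invertible. -/
theorem add_mem_leadingExponents
    (hm : ∀ α β, ∃ q : K, q ≠ 0 ∧ m α * m β - q • m (α + β) ∈ o.spanBelow m K (α + β))
    {I : Ideal A} (α : σ →₀ ℕ) {β : σ →₀ ℕ} (hβ : β ∈ o.leadingExponents m K I) :
    α + β ∈ o.leadingExponents m K I := by
  obtain ⟨a, ha, hab⟩ := hβ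
  obtain ⟨q, hq0, hq⟩ := hm α β
  refine ⟨q⁻¹ • (m α * a), Submodule.smul_of_tower_mem I _ (I.mul_mem_left _ ha), ?_⟩
  have h := Submodule.smul_mem _ q⁻¹ (add_mem (mul_mem_spanBelow hm α β hab) hq)
  have e : q⁻¹ • (m α * (a - m β) + (m α * m β - q • m (α + β))) =
      q⁻¹ • (m α * a) - m (α + β) := by
    rw [mul_sub, sub_add_sub_cancel, smul_sub, smul_smul, inv_mul_cancel₀ hq0, one_smul]
  rwa [e] at h

/-- Take `β` to be the largest exponent in some expression of `b`. The monomials may be linearly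
dependent, so `β` need not be unique and `c` may vanish. -/
theorem eq_zero_or_exists_of_mem_span {S : Set (σ →₀ ℕ)} {b : A}
    (hb : b ∈ Submodule.span K (m '' S)) :
    b = 0 ∨ ∃ β ∈ S, ∃ c : K, b - c • m β ∈ o.spanBelow m K β := by
  have key : b = 0 ∨ ∃ β ∈ S, b ∈ Submodule.span K (m '' {γ | γ ≼[o] β}) := by
    refine Submodule.span_induction (p := fun b _ => b = 0 ∨ ∃ β ∈ S,
      b ∈ Submodule.span K (m '' {γ | γ ≼[o] β})) ?_ (Or.inl rfl) ?_ ?_ hb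
    · rintro _ ⟨β, hβ, rfl⟩
      exact Or.inr ⟨β, hβ, Submodule.subset_span ⟨β, le_refl _, rfl⟩⟩
    · rintro a b - - (rfl | ⟨β, hβ, ha⟩) (rfl | ⟨γ, hγ, hb⟩)
      · simp
      · exact Or.inr ⟨γ, hγ, by simpa using hb⟩
      · exact Or.inr ⟨β, hβ, by simpa using ha⟩
      · right
        rcases le_total (o.toSyn β) (o.toSyn γ) with h | h
        · exact ⟨γ, hγ, add_mem (Submodule.span_mono
            (Set.image_mono fun _ hδ => le_trans hδ h) ha) hb⟩
        · exact ⟨β, hβ, add_mem ha (Submodule.span_mono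
            (Set.image_mono fun _ hδ => le_trans hδ h) hb)⟩
    · rintro c a - (rfl | ⟨β, hβ, ha⟩)
      · simp
      · exact Or.inr ⟨β, hβ, Submodule.smul_mem _ _ ha⟩
  refine key.imp_right ?_
  rintro ⟨β, hβ, h⟩
  refine ⟨β, hβ, ?_⟩
  have e : {γ | γ ≼[o] β} = insert β {γ | γ ≺[o] β} := by
    ext γ
    simp [le_iff_eq_or_lt]
  rw [e, Set.image_insert_eq, Submodule.mem_span_insert] at h
  obtain ⟨c, z, hz, rfl⟩ := h
  exact ⟨c, by rwa [add_sub_cancel_left]⟩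

/-- Division algorithm: subtract from an element of `J` an element of `I` with the same leading
term, and recurse along the well-founded monomial order. -/
theorem le_of_leadingExponents_subset (hspan : Submodule.span K (Set.range m) = ⊤)
    {I J : Ideal A} (hIJ : I ≤ J)
    (h : o.leadingExponents m K J ⊆ o.leadingExponents m K I) : J ≤ I := by
  have key : ∀ s : o.syn, ∀ β, o.toSyn β = s → ∀ a ∈ J,
      (∃ c : K, a - c • m β ∈ o.spanBelow m K β) → a ∈ I := by
    intro s
    induction s using WellFoundedLT.induction with
    | ind s ih =>
      have ih' : ∀ β, o.toSyn β = s → ∀ b ∈ J, b ∈ o.spanBelow m K β → b ∈ I := by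
        intro β hβ b hb hbβ
        rcases eq_zero_or_exists_of_mem_span (o := o) hbβ with rfl | ⟨γ, hγ, hc⟩
        · exact I.zero_mem
        · exact ih _ (hβ ▸ hγ) γ rfl b hb hc
      rintro β hβ a ha ⟨c, hc⟩
      by_cases hc0 : c = 0
      · exact ih' β hβ a ha (by simpa [hc0] using hc)
      have hJ : β ∈ o.leadingExponents m K J := by
        refine ⟨c⁻¹ • a, Submodule.smul_of_tower_mem J _ ha, ?_⟩
        have := Submodule.smul_mem _ c⁻¹ hc
        rwa [smul_sub, smul_smul, inv_mul_cancel₀ hc0, one_smul] at this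
      obtain ⟨b, hb, hbβ⟩ := h hJ
      have hcb : c • b ∈ I := Submodule.smul_of_tower_mem I _ hb
      have : a - c • b ∈ I := by
        refine ih' β hβ _ (sub_mem ha (hIJ hcb)) ?_
        have e : a - c • b = (a - c • m β) - c • (b - m β) := by
          rw [smul_sub]; abel
        rw [e]
        exact sub_mem hc (Submodule.smul_mem _ c hbβ)
      simpa using add_mem this hcb
  intro a ha
  have ha' : a ∈ Submodule.span K (m '' Set.univ) := by
    rw [Set.image_univ, hspan]
    exact Submodule.mem_top
  rcases eq_zero_or_exists_of_mem_span (o := o) ha' with rfl | ⟨β, -, hβ⟩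
  · exact I.zero_mem
  · exact key _ β rfl a ha hβ

/-- An algebra spanned by monomials that multiply, up to smaller monomials, like those of a
quantum affine space in finitely many variables is left noetherian. -/
theorem isNoetherianRing_of_quasiCommuting [Finite σ]
    (hspan : Submodule.span K (Set.range m) = ⊤)
    (hm : ∀ α β, ∃ q : K, q ≠ 0 ∧ m α * m β - q • m (α + β) ∈ o.spanBelow m K (α + β)) :
    IsNoetherianRing A := by
  refine isNoetherian_iff'.2 ⟨?_⟩
  rw [wellFounded_iff_isEmpty_descending_chain]
  refine ⟨fun ⟨I, hI⟩ => ?_⟩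
  have hmono : Monotone I := monotone_nat_of_le_succ fun k => (hI k).le
  have : ∀ k, ∃ α ∈ o.leadingExponents m K (I (k + 1)), α ∉ o.leadingExponents m K (I k) :=
    fun k => Set.not_subset.1 fun h => (hI k).not_ge
      (le_of_leadingExponents_subset hspan (hI k).le h)
  choose α hα hα' using this
  -- Dickson's lemma: `α j` is a translate of an earlier `α i`, hence already a leading exponent of
  -- `I (i + 1) ≤ I j`.
  obtain ⟨i, j, hij, hle⟩ := wellQuasiOrdered_le α
  obtain ⟨β, hβ⟩ := exists_add_of_le hle
  refine hα' j ?_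
  rw [hβ, add_comm]
  exact add_mem_leadingExponents hm β (leadingExponents_mono (hmono (Nat.succ_le_of_lt hij)) (hα i))

end MonomialOrder

/-! ### Skew PBW extensions of a field are left noetherian -/

section Words

variable {K A : Type*} [Field K] [Ring A] [Algebra K A] {n : ℕ} (x : Fin n → A)

/-- The span of the words of length less than `k` in the variables `x`. -/
def wordSpan (K : Type*) [Field K] [Algebra K A] (k : ℕ) : Submodule K A :=
  Submodule.span K ((fun l : List (Fin n) => (l.map x).prod) '' {l | l.length < k})

variable {x}

theorem prod_mem_wordSpan {l : List (Fin n)} {k : ℕ} (h : l.length < k) :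
    (l.map x).prod ∈ wordSpan x K k :=
  Submodule.subset_span ⟨l, h, rfl⟩

theorem mul_mem_wordSpan (i : Fin n) {k : ℕ} {a : A} (ha : a ∈ wordSpan x K k) :
    x i * a ∈ wordSpan x K (k + 1) := by
  have : wordSpan x K k ≤ (wordSpan x K (k + 1)).comap (LinearMap.mulLeft K (x i)) := by
    refine Submodule.span_le.2 ?_
    rintro _ ⟨l, hl, rfl⟩
    have hl' : (i :: l).length < k + 1 := by simpa using hl
    simpa using prod_mem_wordSpan (K := K) (x := x) hl'
  exact this ha

/-- Swapping two adjacent letters costs a nonzero scalar and an error in which the two letters are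
replaced by at most one. -/
theorem prod_map_perm_mem_wordSpan
    (hx : ∀ i j, ∃ d : K, d ≠ 0 ∧ CommutesUpTo (algebraMap K A) x i j d)
    {l l' : List (Fin n)} (h : l.Perm l') :
    ∃ q : K, q ≠ 0 ∧ (l.map x).prod - q • (l'.map x).prod ∈ wordSpan x K l.length := by
  induction h with
  | nil => exact ⟨1, one_ne_zero, by simp⟩
  | cons i _ ih =>
    obtain ⟨q, hq0, hq⟩ := ih
    refine ⟨q, hq0, ?_⟩
    simpa [mul_sub] using mul_mem_wordSpan i hq
  | swap i j l =>
    obtain ⟨d, hd0, r₀, r, hr⟩ := hx i j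
    refine ⟨d, hd0, ?_⟩
    have e : ((j :: i :: l).map x).prod - d • ((i :: j :: l).map x).prod =
        r₀ • (l.map x).prod + ∑ k, r k • ((k :: l).map x).prod := by
      have := congrArg (· * (l.map x).prod) hr
      simpa [sub_mul, add_mul, Finset.sum_mul, mul_assoc, Algebra.smul_def] using this
    rw [e]
    refine add_mem (Submodule.smul_mem _ _ (prod_mem_wordSpan (by simp)))
      (sum_mem fun k _ => Submodule.smul_mem _ _ (prod_mem_wordSpan (by simp)))
  | trans h₁ _ ih₁ ih₂ =>
    obtain ⟨q, hq0, hq⟩ := ih₁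
    obtain ⟨p, hp0, hp⟩ := ih₂
    refine ⟨q * p, mul_ne_zero hq0 hp0, ?_⟩
    rw [← h₁.length_eq] at hp
    simpa [smul_sub, smul_smul] using add_mem hq (Submodule.smul_mem _ q hp)

/-- The word of a standard monomial. -/
def standardWord (α : Fin n → ℕ) : List (Fin n) :=
  (List.ofFn fun i => List.replicate (α i) i).flatten

theorem prod_map_standardWord (α : Fin n → ℕ) :
    ((standardWord α).map x).prod = stdMonomial x α := by
  simp [standardWord, stdMonomial, List.map_flatten, List.prod_flatten, List.map_ofFn,
    Function.comp_def]

theorem count_standardWord (α : Fin n → ℕ) (i : Fin n) : (standardWord α).count i = α i := by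
  simp [standardWord, List.count_flatten, List.map_ofFn, Function.comp_def, List.sum_ofFn,
    List.count_replicate]

theorem perm_standardWord_count (l : List (Fin n)) :
    l.Perm (standardWord fun i => l.count i) :=
  List.perm_iff_count.2 fun i =>
    (count_standardWord (fun i => l.count i) i).symm

theorem length_standardWord (α : Fin n → ℕ) : (standardWord α).length = ∑ i, α i := by
  simp [standardWord, List.length_flatten, List.map_ofFn, Function.comp_def, List.sum_ofFn]

/-- Sort a word into a standard monomial of the same degree; the error consists of shorter words,
covered by induction. -/
theorem wordSpan_le_span_stdMonomial
    (hx : ∀ i j, ∃ d : K, d ≠ 0 ∧ CommutesUpTo (algebraMap K A) x i j d) (k : ℕ) :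
    wordSpan x K k ≤ Submodule.span K
      ((fun α : Fin n →₀ ℕ => stdMonomial x α) '' {α | α.degree < k}) := by
  induction k with
  | zero =>
    refine Submodule.span_le.2 ?_
    rintro _ ⟨l, hl, rfl⟩
    simp at hl
  | succ k ih =>
    refine Submodule.span_le.2 ?_
    rintro _ ⟨l, hl, rfl⟩
    have hl' : l.length ≤ k := Nat.lt_succ_iff.1 hl
    obtain ⟨q, -, hq⟩ := prod_map_perm_mem_wordSpan hx (perm_standardWord_count l)
    have h₁ := ih (Submodule.span_mono (Set.image_mono fun w hw => lt_of_lt_of_le hw hl') hq)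
    have hsub : {α : Fin n →₀ ℕ | α.degree < k} ⊆ {α | α.degree < k + 1} :=
      fun α hα => Nat.lt_succ_of_lt hα
    have h₂ := Submodule.span_mono (Set.image_mono hsub) h₁
    rw [prod_map_standardWord] at h₂
    have h₃ : stdMonomial x (fun i => l.count i) ∈ Submodule.span K
        ((fun α : Fin n →₀ ℕ => stdMonomial x α) '' {α | α.degree < k + 1}) := by
      refine Submodule.subset_span ⟨Finsupp.equivFunOnFinite.symm fun i => l.count i, ?_, rfl⟩
      have hlen : ∑ i, l.count i = l.length := by
        rw [(perm_standardWord_count l).length_eq, length_standardWord]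
      simpa [Finsupp.degree_eq_sum, hlen] using hl
    have h₄ := add_mem h₂ (Submodule.smul_mem _ q h₃)
    rwa [sub_add_cancel] at h₄

theorem stdMonomial_mul_stdMonomial_mem_spanBelow
    (hx : ∀ i j, ∃ d : K, d ≠ 0 ∧ CommutesUpTo (algebraMap K A) x i j d) (α β : Fin n →₀ ℕ) :
    ∃ q : K, q ≠ 0 ∧ stdMonomial x α * stdMonomial x β - q • stdMonomial x ⇑(α + β) ∈
      (MonomialOrder.degLex (σ := Fin n)).spanBelow (fun γ => stdMonomial x γ) K (α + β) := by
  have hperm : (standardWord α ++ standardWord β).Perm (standardWord ⇑(α + β)) :=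
    List.perm_iff_count.2 fun i => by simp [count_standardWord]
  obtain ⟨q, hq0, hq⟩ := prod_map_perm_mem_wordSpan hx hperm
  refine ⟨q, hq0, ?_⟩
  rw [List.map_append, List.prod_append, prod_map_standardWord, prod_map_standardWord,
    prod_map_standardWord, hperm.length_eq, length_standardWord] at hq
  refine Submodule.span_mono (Set.image_mono fun γ hγ => ?_) (wordSpan_le_span_stdMonomial hx _ hq)
  simp only [Set.mem_ofPred_eq] at hγ ⊢
  rw [MonomialOrder.degLex_lt_iff, Finsupp.DegLex.lt_iff]
  -- The errors have smaller total degree, which `degLex` compares first.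
  left
  simpa [Finsupp.degree_eq_sum] using hγ

end Words

theorem IsSkewPBWExtension.isNoetherianRing {K A : Type*} [Field K] [Ring A] [Algebra K A] {n : ℕ}
    {x : Fin n → A} (h : IsSkewPBWExtension (algebraMap K A) x) : IsNoetherianRing A := by
  refine MonomialOrder.isNoetherianRing_of_quasiCommuting (o := MonomialOrder.degLex)
    (m := fun γ : Fin n →₀ ℕ => stdMonomial x γ) ?_
    (stdMonomial_mul_stdMonomial_mem_spanBelow h.comm)
  refine eq_top_iff.2 fun a _ => ?_
  obtain ⟨c, rfl⟩ := h.basis.2 a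
  refine sum_mem fun α _ => ?_
  simp only [← Algebra.smul_def]
  exact Submodule.smul_mem _ _ (Submodule.subset_span ⟨Finsupp.equivFunOnFinite.symm α, rfl⟩)

/-! ### Generators and normal forms of generalized Heisenberg algebras -/

namespace GenHeisenberg

open Polynomial GenHeisenbergVar

variable {K : Type*} [Field K] (f : K[X])

theorem t_mul_x : gen f t * gen f x = gen f x * aeval (gen f t) f := by
  have h := RingQuot.mkAlgHom_rel K (Relation.tx (f := f))
  rwa [map_mul, map_mul, ← aeval_algHom_apply] at h

theorem y_mul_t : gen f y * gen f t = aeval (gen f t) f * gen f y := by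
  have h := RingQuot.mkAlgHom_rel K (Relation.yt (f := f))
  rwa [map_mul, map_mul, ← aeval_algHom_apply] at h

theorem y_mul_x_sub : gen f y * gen f x - gen f x * gen f y = aeval (gen f t) f - gen f t := by
  have h := RingQuot.mkAlgHom_rel K (Relation.yx (f := f))
  rwa [map_sub, map_sub, map_mul, map_mul, ← aeval_algHom_apply] at h

section Lift

variable {f} {B : Type*} [Ring B] [Algebra K B] (b : GenHeisenbergVar → B)
  (htx : b t * b x = b x * aeval (b t) f) (hyt : b y * b t = aeval (b t) f * b y)
  (hyx : b y * b x - b x * b y = aeval (b t) f - b t)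

/-- The universal property of `H(f)`. -/
noncomputable def lift : GenHeisenberg f →ₐ[K] B :=
  RingQuot.liftAlgHom K ⟨FreeAlgebra.lift K b, by
    rintro _ _ (_ | _ | _) <;> simpa [← aeval_algHom_apply]⟩

theorem lift_gen (v : GenHeisenbergVar) : lift b htx hyt hyx (gen f v) = b v := by
  simp [lift, gen]

end Lift

theorem adjoin_range_gen : Algebra.adjoin K (Set.range (gen f)) = ⊤ := by
  have : Set.range (gen f) = RingQuot.mkAlgHom K (Relation f) '' Set.range (FreeAlgebra.ι K) := by
    rw [← Set.range_comp]
    rfl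
  rw [this, Algebra.adjoin_image, FreeAlgebra.adjoin_range_ι, Algebra.map_top,
    AlgHom.range_eq_top]
  exact RingQuot.mkAlgHom_surjective K _

variable {f} in
theorem mem_subalgebra {S : Subalgebra K (GenHeisenberg f)} (hx : gen f x ∈ S)
    (hy : gen f y ∈ S) (ht : gen f t ∈ S) (a : GenHeisenberg f) : a ∈ S := by
  have : (⊤ : Subalgebra K (GenHeisenberg f)) ≤ S := by
    rw [← adjoin_range_gen, Algebra.adjoin_le_iff]
    rintro _ ⟨_ | _ | _, rfl⟩ <;> assumption
  exact this trivial

section Stabilizer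

variable {A V : Type*} [Ring A] [Algebra K A] [AddCommGroup V] [Module K V]

/-- The elements of `A` that preserve the subspace `N` of a representation of `A`. -/
def stabilizer (ρ : A →ₐ[K] Module.End K V) (N : Submodule K V) : Subalgebra K A where
  carrier := {a | ∀ v ∈ N, ρ a v ∈ N}
  mul_mem' := fun {a b} ha hb v hv => by
    rw [map_mul]
    exact ha _ (hb v hv)
  add_mem' := fun {a b} ha hb v hv => by
    rw [map_add]
    exact add_mem (ha v hv) (hb v hv)
  algebraMap_mem' := fun r v hv => by
    rw [AlgHom.commutes, Module.algebraMap_end_apply]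
    exact N.smul_mem r hv

end Stabilizer

/-- `H(f)` is isomorphic to its opposite, by an isomorphism exchanging `x` and `y`. -/
theorem nonempty_ringEquiv_op : Nonempty (GenHeisenberg f ≃+* (GenHeisenberg f)ᵐᵒᵖ) := by
  have haeval (p : K[X]) : aeval (MulOpposite.op (gen f t)) p =
      MulOpposite.op (aeval (gen f t) p) := by
    induction p using Polynomial.induction_on' with
    | add p q hp hq => simp [hp, hq]
    | monomial n a => simp [aeval_monomial, Algebra.commutes, MulOpposite.algebraMap_apply,
        ← MulOpposite.op_pow, ← MulOpposite.op_mul]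
  let φ : GenHeisenberg f →ₐ[K] (GenHeisenberg f)ᵐᵒᵖ :=
    lift (fun v => GenHeisenbergVar.rec (MulOpposite.op (gen f y)) (MulOpposite.op (gen f x))
      (MulOpposite.op (gen f t)) v)
      (by simp only [haeval, ← MulOpposite.op_mul, y_mul_t])
      (by simp only [haeval, ← MulOpposite.op_mul, t_mul_x])
      (by simp only [haeval, ← MulOpposite.op_mul, ← MulOpposite.op_sub, y_mul_x_sub])
  -- `φ` is its own inverse: the elements on which `φ` applied twice is the identity form a
  -- subalgebra containing the generators.
  let S : Subalgebra K (GenHeisenberg f) :=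
    { carrier := {a | φ (φ a).unop = MulOpposite.op a}
      mul_mem' := fun {a b} (ha : _ = _) (hb : _ = _) => by
        simp [ha, hb]
      add_mem' := fun {a b} (ha : _ = _) (hb : _ = _) => by
        simp [ha, hb]
      algebraMap_mem' := fun r => by
        simp [MulOpposite.algebraMap_apply] }
  have hφ (a) : φ (φ a).unop = MulOpposite.op a := by
    refine mem_subalgebra (S := S) ?_ ?_ ?_ a <;>
    · change φ (φ _).unop = _
      simp only [φ, lift_gen, MulOpposite.unop_op]
  exact ⟨{ φ with
    invFun := fun a => (φ a.unop).unop
    left_inv := fun a => by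
      change (φ (φ a).unop).unop = a
      rw [hφ, MulOpposite.unop_op]
    right_inv := fun a => hφ a.unop }⟩

/-- The `n`-fold composition iterate of `f`. -/
noncomputable def iter : ℕ → K[X]
  | 0 => X
  | n + 1 => f.comp (iter n)

@[simp] theorem iter_zero : iter f 0 = X := rfl

theorem iter_succ (n : ℕ) : iter f (n + 1) = f.comp (iter f n) := rfl

@[simp] theorem iter_one : iter f 1 = f := by simp [iter_succ]

theorem iter_comp (n : ℕ) : (iter f n).comp f = iter f (n + 1) := by
  induction n with
  | zero => simp [iter_succ]
  | succ n ih => rw [iter_succ, comp_assoc, ih, ← iter_succ]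

theorem natDegree_iter (n : ℕ) : (iter f n).natDegree = f.natDegree ^ n := by
  induction n with
  | zero => simp
  | succ n ih => rw [iter_succ, natDegree_comp, ih, pow_succ']

theorem aeval_t_mul_x (p : K[X]) :
    aeval (gen f t) p * gen f x = gen f x * aeval (gen f t) (p.comp f) := by
  have h : (aeval (gen f t) p) * gen f x = gen f x * aeval (aeval (gen f t) f) p := by
    induction p using Polynomial.induction_on' with
    | add p q hp hq => simp only [map_add, add_mul, mul_add, hp, hq]
    | monomial n a =>
      have hs : SemiconjBy (gen f x) (aeval (gen f t) f) (gen f t) := (t_mul_x f).symm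
      rw [aeval_monomial, aeval_monomial, mul_assoc, ← (hs.pow_right n).eq, Algebra.left_comm]
  rw [h, aeval_comp]

theorem y_mul_aeval_t (p : K[X]) :
    gen f y * aeval (gen f t) p = aeval (gen f t) (p.comp f) * gen f y := by
  have h : gen f y * aeval (gen f t) p = aeval (aeval (gen f t) f) p * gen f y := by
    induction p using Polynomial.induction_on' with
    | add p q hp hq => simp only [map_add, add_mul, mul_add, hp, hq]
    | monomial n a =>
      have hs : SemiconjBy (gen f y) (gen f t) (aeval (gen f t) f) := y_mul_t f
      rw [aeval_monomial, aeval_monomial, mul_assoc, ← (hs.pow_right n).eq, Algebra.left_comm]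
  rw [h, aeval_comp]

theorem aeval_t_mul_x_pow (p : K[X]) (i : ℕ) :
    aeval (gen f t) p * gen f x ^ i = gen f x ^ i * aeval (gen f t) (p.comp (iter f i)) := by
  induction i with
  | zero => simp
  | succ i ih => rw [pow_succ, ← mul_assoc, ih, mul_assoc, aeval_t_mul_x, comp_assoc, iter_comp,
      mul_assoc]

theorem y_mul_x_pow (i : ℕ) : gen f y * gen f x ^ i =
    gen f x ^ i * gen f y + gen f x ^ (i - 1) * aeval (gen f t) (iter f i - X) := by
  induction i with
  | zero => simp
  | succ i ih =>
    have h : gen f x ^ (i - 1) * aeval (gen f t) (iter f i - X) * gen f x =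
        gen f x ^ i * aeval (gen f t) (iter f (i + 1) - f) := by
      rw [mul_assoc, aeval_t_mul_x, sub_comp, iter_comp, X_comp, ← mul_assoc, ← pow_succ]
      -- For `i = 0` the exponent `i - 1` is truncated, but both sides vanish since `iter f 1 = f`.
      cases i with
      | zero => simp [iter_succ]
      | succ i => rfl
    rw [pow_succ, ← mul_assoc, ih, add_mul, h, mul_assoc, sub_eq_iff_eq_add.1 (y_mul_x_sub f)]
    simp only [map_sub, aeval_X, mul_add, mul_sub, Nat.add_sub_cancel, mul_assoc]
    abel

/-- The normally ordered elements `x ^ i * g(t) * y ^ j` span `H(f)`. -/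
theorem mem_of_normalOrdered {S : AddSubmonoid (GenHeisenberg f)}
    (hS : ∀ (i j : ℕ) (g : K[X]), gen f x ^ i * aeval (gen f t) g * gen f y ^ j ∈ S)
    (a : GenHeisenberg f) : a ∈ S := by
  let N : Submodule K (GenHeisenberg f) := Submodule.span K
    (Set.range fun p : (ℕ × ℕ) × K[X] =>
      gen f x ^ p.1.1 * aeval (gen f t) p.2 * gen f y ^ p.1.2)
  have hN (i j : ℕ) (g : K[X]) : gen f x ^ i * aeval (gen f t) g * gen f y ^ j ∈ N :=
    Submodule.subset_span ⟨((i, j), g), rfl⟩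
  have key (b : GenHeisenberg f)
      (hb : ∀ (i j : ℕ) (g : K[X]), b * (gen f x ^ i * aeval (gen f t) g * gen f y ^ j) ∈ N) :
      ∀ v ∈ N, Algebra.lmul K _ b v ∈ N := by
    have : N ≤ N.comap (Algebra.lmul K _ b) := by
      refine Submodule.span_le.2 ?_
      rintro _ ⟨⟨⟨i, j⟩, g⟩, rfl⟩
      exact hb i j g
    exact this
  have haN : a ∈ N := by
    -- `N` contains `1` and is stable under left multiplication by the generators, so it contains `a
    -- * 1`.
    have h1 : (1 : GenHeisenberg f) ∈ N := by simpa using hN 0 0 1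
    have := mem_subalgebra (S := stabilizer (Algebra.lmul K (GenHeisenberg f)) N)
      (key _ ?_) (key _ ?_) (key _ ?_) a 1 h1
    · simpa using this
    · intro i j g
      have := hN (i + 1) j g
      rwa [pow_succ', mul_assoc, mul_assoc, ← mul_assoc (gen f x ^ i)] at this
    · intro i j g
      rw [← mul_assoc, ← mul_assoc, y_mul_x_pow, add_mul, add_mul, mul_assoc (gen f x ^ i),
        y_mul_aeval_t, ← mul_assoc, mul_assoc _ (gen f y), ← pow_succ', mul_assoc (gen f x ^ (i - 1)),
        ← map_mul]
      exact add_mem (hN _ _ _) (hN _ _ _)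
    · intro i j g
      have h := aeval_t_mul_x_pow f X i
      rw [aeval_X, X_comp] at h
      rw [← mul_assoc, ← mul_assoc, h, mul_assoc (gen f x ^ i), ← map_mul]
      exact hN _ _ _
  -- An additive submonoid suffices because scalars are absorbed into `g`.
  refine Submodule.closure_induction (p := fun a _ => a ∈ S) S.zero_mem
    (fun _ _ _ _ => S.add_mem) ?_ haN
  rintro c _ ⟨⟨⟨i, j⟩, g⟩, rfl⟩
  have := hS i j (c • g)
  rwa [map_smul, mul_smul_comm, smul_mul_assoc] at this

/-! ### A family of representations of `H(f)` -/

variable (e : K)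

/-- The action of the generators on the space with basis `x ^ i * t ^ k * y ^ j`; for `e = 1` it is
left multiplication, and for `e = 0` it is a `K[t]`-linear degeneration of it. -/
noncomputable def repGen : GenHeisenbergVar → Module.End K (ℕ × ℕ →₀ K[X])
  | x => Finsupp.lmapDomain K[X] K fun p => (p.1 + 1, p.2)
  | y => Finsupp.lsum K fun p =>
      e • Finsupp.lsingle (p.1, p.2 + 1) ∘ₗ (aeval f).toLinearMap +
        -- The truncation at `p.1 = 0` is harmless: `iter f 0 - X = 0`.
        Finsupp.lsingle (p.1 - 1, p.2) ∘ₗ LinearMap.mulLeft K (iter f p.1 - X)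
  | t => Finsupp.lsum K fun p => Finsupp.lsingle p ∘ₗ LinearMap.mulLeft K (iter f p.1)

theorem repGen_x_single (p : ℕ × ℕ) (g : K[X]) :
    repGen f e x (Finsupp.single p g) = Finsupp.single (p.1 + 1, p.2) g := by
  simp [repGen]

theorem repGen_y_single (p : ℕ × ℕ) (g : K[X]) :
    repGen f e y (Finsupp.single p g) = e • Finsupp.single (p.1, p.2 + 1) (g.comp f) +
      Finsupp.single (p.1 - 1, p.2) ((iter f p.1 - X) * g) := by
  simp [repGen, comp, aeval_def, algebraMap_eq]

theorem repGen_t_single (p : ℕ × ℕ) (g : K[X]) :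
    repGen f e t (Finsupp.single p g) = Finsupp.single p (iter f p.1 * g) := by
  simp [repGen]

theorem aeval_repGen_t_single (q : K[X]) (p : ℕ × ℕ) (g : K[X]) :
    aeval (repGen f e t) q (Finsupp.single p g) =
      Finsupp.single p (q.comp (iter f p.1) * g) := by
  induction q using Polynomial.induction_on' with
  | add q r hq hr => simp [hq, hr, add_mul]
  | monomial n a =>
    have h (n : ℕ) : (repGen f e t ^ n) (Finsupp.single p g) =
        Finsupp.single p (iter f p.1 ^ n * g) := by
      induction n with
      | zero => simp
      | succ n ih => rw [pow_succ', Module.End.mul_apply, ih, repGen_t_single, pow_succ', mul_assoc]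
    simp [aeval_monomial, h, Module.algebraMap_end_apply, smul_eq_C_mul, mul_assoc,
      -Finsupp.single_mul]

/-- The representations of `H(f)` given by `repGen`. -/
noncomputable def rep : GenHeisenberg f →ₐ[K] Module.End K (ℕ × ℕ →₀ K[X]) :=
  lift (repGen f e)
    (by
      refine Finsupp.lhom_ext fun p g => ?_
      simp only [Module.End.mul_apply, repGen_x_single, repGen_t_single, aeval_repGen_t_single,
        iter_succ])
    (by
      refine Finsupp.lhom_ext fun p g => ?_
      obtain ⟨_ | i, j⟩ := p <;>
      simp [Module.End.mul_apply, repGen_y_single, repGen_t_single, aeval_repGen_t_single,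
        iter_comp, ← iter_succ, mul_left_comm, -Finsupp.single_mul])
    (by
      refine Finsupp.lhom_ext fun p g => ?_
      obtain ⟨_ | i, j⟩ := p <;>
      simp [Module.End.mul_apply, repGen_y_single, repGen_t_single, aeval_repGen_t_single,
        repGen_x_single, ← iter_succ, sub_mul, Finsupp.single_sub, -Finsupp.single_mul])

theorem rep_x_single (p : ℕ × ℕ) (g : K[X]) :
    rep f e (gen f x) (Finsupp.single p g) = Finsupp.single (p.1 + 1, p.2) g := by
  rw [rep, lift_gen, repGen_x_single]

theorem rep_y_single (p : ℕ × ℕ) (g : K[X]) :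
    rep f e (gen f y) (Finsupp.single p g) = e • Finsupp.single (p.1, p.2 + 1) (g.comp f) +
      Finsupp.single (p.1 - 1, p.2) ((iter f p.1 - X) * g) := by
  rw [rep, lift_gen, repGen_y_single]

theorem rep_aeval_t_single (q : K[X]) (p : ℕ × ℕ) (g : K[X]) :
    rep f e (aeval (gen f t) q) (Finsupp.single p g) =
      Finsupp.single p (q.comp (iter f p.1) * g) := by
  rw [← aeval_algHom_apply, rep, lift_gen, aeval_repGen_t_single]

theorem rep_t_single (p : ℕ × ℕ) (g : K[X]) :
    rep f e (gen f t) (Finsupp.single p g) = Finsupp.single p (iter f p.1 * g) := by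
  rw [rep, lift_gen, repGen_t_single]

theorem rep_x_pow_single (i : ℕ) (p : ℕ × ℕ) (g : K[X]) :
    rep f e (gen f x ^ i) (Finsupp.single p g) = Finsupp.single (p.1 + i, p.2) g := by
  induction i with
  | zero => simp
  | succ i ih => rw [pow_succ', map_mul, Module.End.mul_apply, ih, rep_x_single, add_assoc]

theorem rep_y_pow_single (j : ℕ) :
    rep f 1 (gen f y ^ j) (Finsupp.single (0, 0) 1) = Finsupp.single (0, j) 1 := by
  induction j with
  | zero => simp
  | succ j ih => rw [pow_succ', map_mul, Module.End.mul_apply, ih, rep_y_single]; simp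

/-- `rep f 1` separates the normally ordered elements. -/
theorem rep_normalOrdered (i j : ℕ) (g : K[X]) :
    rep f 1 (gen f x ^ i * aeval (gen f t) g * gen f y ^ j) (Finsupp.single (0, 0) 1) =
      Finsupp.single (i, j) g := by
  rw [map_mul, map_mul, Module.End.mul_apply, Module.End.mul_apply, rep_y_pow_single,
    rep_aeval_t_single, rep_x_pow_single]
  simp

end GenHeisenberg

namespace GenHeisenberg

open Polynomial GenHeisenbergVar

variable {K : Type*} [Field K] {f : K[X]}

theorem mem_submodule_of_single {α M V : Type*} [AddCommGroup M] [Module K M] [AddCommGroup V]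
    [Module K V] {J : α → Submodule K M} {N : Submodule K V} (L : (α →₀ M) →ₗ[K] V)
    (h : ∀ p, ∀ g ∈ J p, L (Finsupp.single p g) ∈ N) {v : α →₀ M}
    (hv : v ∈ Finsupp.submodule J) : L v ∈ N := by
  rw [← v.sum_single, map_finsuppSum]
  exact sum_mem fun p _ => h p _ ((Finsupp.mem_submodule_iff _ _).1 hv p)

theorem single_mem_submodule {α M : Type*} [AddCommGroup M] [Module K M] {J : α → Submodule K M}
    {p : α} {g : M} (h : g ∈ J p) : Finsupp.single p g ∈ Finsupp.submodule J := by
  classical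
  rw [Finsupp.mem_submodule_iff]
  intro q
  rw [Finsupp.single_apply]
  split_ifs with hq
  · exact hq ▸ h
  · exact zero_mem _

/-! ### Noetherian generalized Heisenberg algebras -/

/-- The quotient exists because `p - q` divides `f(p) - f(q)`; take `p = f` and `q = X`. -/
theorem sub_X_dvd_comp (f : K[X]) : f - X ∣ (f - X).comp f := by
  have h := sub_dvd_eval_sub f X (f.map C)
  rw [eval_map, eval_map] at h
  change f - X ∣ f.comp f - f.comp X at h
  rw [comp_X] at h
  rwa [sub_comp, X_comp]

/-- For `deg f = d ≥ 2` the degrees are `d ^ 2 > d`; for constant `f` the composite is zero while `f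
- X` is not. -/
theorem not_comp_dvd_sub_X (hf : f.natDegree ≠ 1) : ¬ (f - X).comp f ∣ f - X := by
  intro h
  have h0 : f - X ≠ 0 := fun h => hf (by rw [sub_eq_zero.1 h, natDegree_X])
  have hle := natDegree_le_of_dvd h h0
  rw [natDegree_comp] at hle
  rcases Nat.lt_or_gt_of_ne hf with hlt | hgt
  · obtain ⟨c, rfl⟩ := natDegree_eq_zero.1 (Nat.lt_one_iff.1 hlt)
    refine h0 (zero_dvd_iff.1 ?_)
    simpa using h
  · rw [natDegree_sub_eq_left_of_natDegree_lt (by simpa using hgt)] at hle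
    nlinarith

/-- A subspace of `rep f 1` separating `(f - t) * y ^ n` from the elements `(f - t) * y ^ k` with
`k < n`. -/
noncomputable def dvdSubmodule (f : K[X]) (n : ℕ) : Submodule K (ℕ × ℕ →₀ K[X]) :=
  Finsupp.submodule fun p =>
    (Ideal.span {if p.2 < n then f - X else (f - X).comp f}).restrictScalars K

/-- Only `y` changes the second index or composes coefficients with `f`; raising that index past `n`
strengthens the divisibility condition exactly as composition with `f` does. -/
theorem stabilizer_dvdSubmodule (f : K[X]) (n : ℕ) (a : GenHeisenberg f) :
    a ∈ stabilizer (rep f 1) (dvdSubmodule f n) := by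
  have hd := sub_X_dvd_comp f
  have hd' := map_dvd (compRingHom f) hd
  simp only [coe_compRingHom_apply] at hd'
  refine mem_subalgebra ?_ ?_ ?_ a <;> refine fun v => mem_submodule_of_single _ fun p g hg => ?_
  · rw [rep_x_single]
    exact single_mem_submodule hg
  · rw [rep_y_single]
    refine add_mem (Submodule.smul_mem _ _ (single_mem_submodule ?_))
      (single_mem_submodule (Ideal.mul_mem_left _ _ hg))
    rw [Submodule.restrictScalars_mem, Ideal.mem_span_singleton] at hg ⊢
    have hg' := map_dvd (compRingHom f) hg
    simp only [coe_compRingHom_apply] at hg'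
    refine dvd_trans ?_ hg'
    split_ifs
    · exact hd
    · omega
    · rfl
    · exact hd'
  · rw [rep_t_single]
    exact single_mem_submodule (Ideal.mul_mem_left _ _ hg)

/-- If the chain stopped at `n`, `w n` would send the vector `single (0, 0) 1` into `dvdSubmodule f
n`, making `(f - X).comp f` divide `f - X`. -/
theorem natDegree_eq_one_of_isNoetherianRing (h : IsNoetherianRing (GenHeisenberg f)) :
    f.natDegree = 1 := by
  by_contra hf
  let w (j : ℕ) : GenHeisenberg f := aeval (gen f t) (f - X) * gen f y ^ j
  have hw (j : ℕ) : rep f 1 (w j) (Finsupp.single (0, 0) 1) = Finsupp.single (0, j) (f - X) := by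
    have h := rep_normalOrdered f 0 j (f - X)
    rwa [pow_zero, one_mul] at h
  let I : ℕ →o Ideal (GenHeisenberg f) :=
    ⟨fun k => Ideal.span (w '' Set.Iio k), fun _ _ hkl =>
      Ideal.span_mono (Set.image_mono (Set.Iio_subset_Iio hkl))⟩
  obtain ⟨n, hn⟩ := monotone_stabilizes_iff_noetherian.2 h I
  have hmem : w n ∈ I n := by
    rw [hn (n + 1) n.le_succ]
    exact Ideal.subset_span ⟨n, Nat.lt_succ_self n, rfl⟩
  have hle : ∀ a ∈ I n, rep f 1 a (Finsupp.single (0, 0) 1) ∈ dvdSubmodule f n := by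
    intro a ha
    refine Submodule.span_induction
      (p := fun a _ => rep f 1 a (Finsupp.single (0, 0) 1) ∈ dvdSubmodule f n) ?_ ?_ ?_ ?_ ha
    · rintro _ ⟨j, hj, rfl⟩
      rw [hw]
      refine single_mem_submodule ?_
      rw [if_pos (show (0, j).2 < n from hj)]
      exact Ideal.mem_span_singleton_self _
    · simp
    · intro a b _ _ ha hb
      rw [map_add]
      exact add_mem ha hb
    · intro a b _ hb
      rw [smul_eq_mul, map_mul]
      exact stabilizer_dvdSubmodule f n a _ hb
  have h₁ := hle _ hmem
  rw [hw, dvdSubmodule, Finsupp.mem_submodule_iff] at h₁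
  have h₂ := h₁ (0, n)
  rw [Finsupp.single_eq_same, if_neg (lt_irrefl n), Submodule.restrictScalars_mem,
    Ideal.mem_span_singleton] at h₂
  exact not_comp_dvd_sub_X hf h₂

end GenHeisenberg

/-! ### Standard monomials of low degree -/

section StdMonomial

variable {R A : Type*} [Ring R] [Ring A] {n : ℕ}

theorem stdMonomial_zero (x : Fin n → A) : stdMonomial x 0 = 1 := by
  simp [stdMonomial]

theorem stdMonomial_single (x : Fin n → A) (i : Fin n) : stdMonomial x (Pi.single i 1) = x i := by
  induction n with
  | zero => exact i.elim0
  | succ n ih =>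
    rw [stdMonomial, List.ofFn_succ, List.prod_cons]
    cases i using Fin.cases with
    | zero =>
      simp
    | succ i =>
      have := ih (fun i => x i.succ) i
      rw [stdMonomial] at this
      simpa [Pi.single_apply] using this

/-- `x i` and `1` are distinct standard monomials. This is what makes the twisting endomorphisms
unique. -/
theorem IsSkewPBWExtension.eq_zero_of_mul_add_eq_zero {ι : R →+* A} {x : Fin n → A}
    (h : IsSkewPBWExtension ι x) {i : Fin n} {a b : R} (hab : ι a * x i + ι b = 0) : a = 0 := by
  classical
  have hc := @h.basis.1 (Finsupp.single (Pi.single i 1) a + Finsupp.single 0 b) 0 (by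
    simp only
    rw [Finsupp.sum_add_index' (by simp) (by simp [add_mul]), Finsupp.sum_single_index (by simp),
      Finsupp.sum_single_index (by simp), stdMonomial_single, stdMonomial_zero, mul_one, hab,
      Finsupp.sum_zero_index])
  have hne : (0 : Fin n → ℕ) ≠ Pi.single i 1 := fun h => by
    simpa using congrFun h i
  simpa [Finsupp.single_apply, hne] using DFunLike.congr_fun hc (Pi.single i 1)

end StdMonomial

namespace GenHeisenberg

open Polynomial GenHeisenbergVar

variable {K : Type*} [Field K] {f : K[X]}

/-! ### Skew PBW extensions of `K[t]` of endomorphism type -/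

/-- At `e = 0` the term of `y` that composes coefficients with `f` disappears; the generators then
only shift indices and multiply by polynomials. -/
theorem rep_zero_smul (a : GenHeisenberg f) : ∀ (g : K[X]) (v : ℕ × ℕ →₀ K[X]),
    rep f 0 a (g • v) = g • rep f 0 a v := by
  let S : Subalgebra K (GenHeisenberg f) :=
    { carrier := {a | ∀ (g : K[X]) (v : ℕ × ℕ →₀ K[X]), rep f 0 a (g • v) = g • rep f 0 a v}
      mul_mem' := fun {a b} ha hb g v => by
        rw [map_mul, Module.End.mul_apply, Module.End.mul_apply, hb, ha]
      add_mem' := fun {a b} ha hb g v => by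
        rw [map_add, LinearMap.add_apply, LinearMap.add_apply, hb, ha, smul_add]
      algebraMap_mem' := fun r g v => by
        rw [AlgHom.commutes, Module.algebraMap_end_apply, Module.algebraMap_end_apply,
          smul_comm] }
  refine mem_subalgebra (S := S) ?_ ?_ ?_ a <;> intro g v <;>
    induction v using Finsupp.induction_linear with
    | zero => simp
    | add v w hv hw => simp only [smul_add, map_add, hv, hw]
    | single p h =>
      simp [rep_x_single, rep_y_single, rep_t_single, mul_left_comm, -Finsupp.single_mul]

theorem rep_aeval_t_apply (e : K) (q : K[X]) (v : ℕ × ℕ →₀ K[X]) (p : ℕ × ℕ) :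
    rep f e (aeval (gen f t) q) v p = q.comp (iter f p.1) * v p := by
  classical
  induction v using Finsupp.induction_linear with
  | zero => simp
  | add v w hv hw => simp [mul_add, hv, hw]
  | single r h =>
    rw [rep_aeval_t_single, Finsupp.single_apply, Finsupp.single_apply]
    split_ifs with hr
    · rw [hr]
    · rw [mul_zero]

/-- The span in `rep f 0` of the basis vectors not involving `x`. -/
noncomputable def xFreeSubmodule (K : Type*) [Field K] : Submodule K (ℕ × ℕ →₀ K[X]) :=
  Finsupp.submodule fun p => if p.1 = 0 then ⊤ else ⊥

theorem mem_xFreeSubmodule {v : ℕ × ℕ →₀ K[X]} :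
    v ∈ xFreeSubmodule K ↔ ∀ p : ℕ × ℕ, p.1 ≠ 0 → v p = 0 := by
  rw [xFreeSubmodule, Finsupp.mem_submodule_iff]
  refine forall_congr' fun p => ?_
  split_ifs with hp <;> simp [hp]

/-- On `x`-free vectors `t` acts as the scalar `X`, so by `K[t]`-linearity `s(t)` acts as `X` on the
image `w`. A nonzero component of `w` at `x`-exponent `i` gives `s ∘ iter f i = X`, so `(deg f) ^ i
= 1` and `i = 0`. -/
theorem mem_stabilizer_of_mul_t (hf : f.natDegree ≠ 1) {a : GenHeisenberg f} {s : K[X]}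
    (hs : s.natDegree = 1) (ha : a * gen f t = aeval (gen f t) s * a) :
    a ∈ stabilizer (rep f 0) (xFreeSubmodule K) := by
  refine fun v => mem_submodule_of_single _ fun p g hg => ?_
  obtain ⟨i, j⟩ := p
  by_cases hi : i = 0
  swap
  · have : g = 0 := by simpa [hi] using hg
    simp [this]
  subst hi
  have hsmul : Finsupp.single (0, j) g = g • Finsupp.single (0, j) (1 : K[X]) := by simp
  set w := rep f 0 a (Finsupp.single (0, j) 1) with hw
  have hXw : rep f 0 (aeval (gen f t) s) w = (X : K[X]) • w := by
    rw [hw, ← Module.End.mul_apply, ← map_mul, ← ha, map_mul, Module.End.mul_apply, rep_t_single,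
      ← rep_zero_smul]
    simp
  rw [hsmul, rep_zero_smul, mem_xFreeSubmodule]
  intro p hp
  have hp' := DFunLike.congr_fun hXw p
  rw [rep_aeval_t_apply, Finsupp.smul_apply, smul_eq_mul] at hp'
  rw [Finsupp.smul_apply, ← hw, smul_eq_mul]
  by_cases h0 : w p = 0
  · rw [h0, mul_zero]
  · have hd := congrArg natDegree (mul_right_cancel₀ h0 hp')
    rw [natDegree_comp, hs, one_mul, natDegree_iter, natDegree_X] at hd
    exact absurd ((Nat.pow_eq_one.1 hd).resolve_right hp) hf

theorem ofPoly_apply (f g : K[X]) : ofPoly f g = aeval (gen f t) g := rfl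

theorem natDegree_eq_one_of_isSkewPBWExtension {n : ℕ} {z : Fin n → GenHeisenberg f}
    (h : IsSkewPBWExtension (ofPoly f) z) (hb : IsBijectiveSkewPBW (ofPoly f) z)
    (he : IsEndomorphismTypeSkewPBW (ofPoly f) z) : f.natDegree = 1 := by
  by_contra hf
  obtain ⟨⟨σ, δ, hσ, hσb⟩, -⟩ := hb
  obtain ⟨τ, ε, hτ, hε⟩ := he
  have hz (i : Fin n) (r : K[X]) : z i * ofPoly f r = ofPoly f (τ i r) * z i := by
    rw [hτ.mul_eq, hε]
    simp
  -- Bijectivity and endomorphism type each supply their own action; uniqueness identifies the two.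
  have hτσ (i : Fin n) (r : K[X]) : τ i r = σ i r := by
    refine sub_eq_zero.1 (h.eq_zero_of_mul_add_eq_zero (i := i) (b := -δ i r) ?_)
    rw [map_sub, sub_mul, ← hz, hσ.mul_eq, map_neg]
    abel
  have hC (i : Fin n) (k : K) : τ i (C k) = C k := by
    refine sub_eq_zero.1 (h.eq_zero_of_mul_add_eq_zero (i := i) (b := 0) ?_)
    rw [map_sub, sub_mul, ← hz, map_zero, add_zero, ofPoly_apply, aeval_C, Algebra.commutes,
      sub_self]
  have hcomp (i : Fin n) (r : K[X]) : τ i r = r.comp (τ i X) := by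
    have : τ i = compRingHom (τ i X) := ringHom_ext (by simp [hC]) (by simp)
    exact DFunLike.congr_fun this r
  -- `τ i` is composition with `τ i X`, and surjectivity onto `X` forces degree 1.
  have hdeg (i : Fin n) : (τ i X).natDegree = 1 := by
    obtain ⟨p, hp⟩ := (hσb i).2 X
    rw [← hτσ, hcomp] at hp
    have := congrArg natDegree hp
    rw [natDegree_comp, natDegree_X] at this
    exact Nat.eq_one_of_mul_eq_one_left this
  have hmem (i : Fin n) : z i ∈ stabilizer (rep f 0) (xFreeSubmodule K) :=
    mem_stabilizer_of_mul_t hf (hdeg i) (by simpa [ofPoly_apply] using hz i X)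
  have hpoly (r : K[X]) : ofPoly f r ∈ stabilizer (rep f 0) (xFreeSubmodule K) := by
    intro v hv
    rw [mem_xFreeSubmodule] at hv ⊢
    intro p hp
    rw [ofPoly_apply, rep_aeval_t_apply, hv p hp, mul_zero]
  have hx : gen f x ∈ stabilizer (rep f 0) (xFreeSubmodule K) := by
    obtain ⟨c, hc⟩ := h.basis.2 (gen f x)
    rw [← hc]
    refine sum_mem fun α _ => mul_mem (hpoly _) (Subalgebra.list_prod_mem _ ?_)
    intro a ha
    obtain ⟨i, rfl⟩ := (List.mem_ofFn' _ _).1 ha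
    exact pow_mem (hmem i) _
  have h1 := hx (Finsupp.single (0, 0) 1) (mem_xFreeSubmodule.2 fun p hp => by
    rw [Finsupp.single_eq_of_ne]
    rintro rfl
    exact hp rfl)
  rw [rep_x_single, mem_xFreeSubmodule] at h1
  simpa using h1 (1, 0) one_ne_zero

end GenHeisenberg

namespace GenHeisenberg

open Polynomial GenHeisenbergVar

variable {K : Type*} [Field K] {f : K[X]}

/-! ### Bases of generalized Heisenberg algebras -/

/-- The coefficient of `x ^ i * y ^ j` of an element of `H(f)` in normal order. -/
noncomputable def coeffHom (f : K[X]) (p : ℕ × ℕ) : GenHeisenberg f →+ K[X] where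
  toFun a := rep f 1 a (Finsupp.single (0, 0) 1) p
  map_zero' := by simp
  map_add' a b := by simp

theorem coeffHom_normalOrdered (p : ℕ × ℕ) (i j : ℕ) (g : K[X]) :
    coeffHom f p (gen f x ^ i * aeval (gen f t) g * gen f y ^ j) =
      if (i, j) = p then g else 0 := by
  classical
  change rep f 1 _ _ p = _
  rw [rep_normalOrdered, Finsupp.single_apply]

theorem ofPoly_injective : Function.Injective (ofPoly f) := by
  intro g h hgh
  have := congrArg (coeffHom f (0, 0)) hgh
  rw [ofPoly_apply, ofPoly_apply] at this
  have hc (g : K[X]) : coeffHom f (0, 0) (aeval (gen f t) g) = g := by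
    simpa using coeffHom_normalOrdered (f := f) (0, 0) 0 0 g
  rwa [hc, hc] at this

theorem algebraMap_injective : Function.Injective (algebraMap K (GenHeisenberg f)) := by
  intro a b hab
  refine C_injective (ofPoly_injective (f := f) ?_)
  rwa [ofPoly_apply, ofPoly_apply, aeval_C, aeval_C]

section DegreeOne

variable {f' : K[X]}

theorem exists_comp_inverse (hf : f.natDegree = 1) :
    ∃ f' : K[X], f.comp f' = X ∧ f'.comp f = X := by
  obtain ⟨a, ha, b, rfl⟩ := natDegree_eq_one.1 hf
  have hC : C a * C a⁻¹ = (1 : K[X]) := by rw [← C_mul, mul_inv_cancel₀ ha, C_1]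
  refine ⟨C a⁻¹ * (X - C b), ?_, ?_⟩
  · simp only [add_comp, mul_comp, C_comp, X_comp]
    linear_combination (X - C b) * hC
  · simp only [mul_comp, sub_comp, C_comp, X_comp]
    linear_combination X * hC

theorem comp_iter_bijective (hf : f.natDegree = 1) (i : ℕ) :
    Function.Bijective fun g : K[X] => g.comp (iter f i) := by
  obtain ⟨q, h₁, h₂⟩ := exists_comp_inverse (f := iter f i) (by rw [natDegree_iter, hf, one_pow])
  refine Function.bijective_iff_has_inverse.2 ⟨fun g => g.comp q, fun g => ?_, fun g => ?_⟩
  · change (g.comp _).comp q = g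
    rw [comp_assoc, h₁, comp_X]
  · change (g.comp q).comp _ = g
    rw [comp_assoc, h₂, comp_X]

theorem stdMonomial_x_y (α : Fin 2 → ℕ) :
    stdMonomial ![gen f x, gen f y] α = gen f x ^ α 0 * gen f y ^ α 1 := by
  simp [stdMonomial, List.ofFn_succ]

theorem ofPoly_mul_stdMonomial (g : K[X]) (α : Fin 2 → ℕ) :
    ofPoly f g * stdMonomial ![gen f x, gen f y] α =
      gen f x ^ α 0 * aeval (gen f t) (g.comp (iter f (α 0))) * gen f y ^ α 1 := by
  rw [stdMonomial_x_y, ofPoly_apply, ← mul_assoc, aeval_t_mul_x_pow]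

/-- Moving a left coefficient past `x ^ i` composes it with `iter f i`, which is bijective in degree
1; this reduces the claim to the normal form. -/
theorem bijective_sum_ofPoly (hf : f.natDegree = 1) :
    Function.Bijective fun c : (Fin 2 → ℕ) →₀ K[X] =>
      c.sum fun α r => ofPoly f r * stdMonomial ![gen f x, gen f y] α := by
  let Φ : ((Fin 2 → ℕ) →₀ K[X]) →+ GenHeisenberg f := Finsupp.liftAddHom fun α =>
    (AddMonoidHom.mulRight (stdMonomial ![gen f x, gen f y] α)).comp (ofPoly f : K[X] →+ _)
  have hsingle (α : Fin 2 → ℕ) (r : K[X]) : Φ (Finsupp.single α r) =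
      gen f x ^ α 0 * aeval (gen f t) (r.comp (iter f (α 0))) * gen f y ^ α 1 := by
    rw [← ofPoly_mul_stdMonomial]
    exact Finsupp.liftAddHom_apply_single _ _ _
  change Function.Bijective Φ
  constructor
  · refine (injective_iff_map_eq_zero Φ).2 fun c hc => Finsupp.ext fun α => ?_
    have key : (coeffHom f (α 0, α 1)).comp Φ =
        (compRingHom (iter f (α 0)) : K[X] →+ K[X]).comp (Finsupp.applyAddHom α) := by
      refine Finsupp.addHom_ext fun β r => ?_
      have hiff : (β 0, β 1) = (α 0, α 1) ↔ β = α := by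
        simp [funext_iff, Fin.forall_fin_two]
      simp only [AddMonoidHom.comp_apply, hsingle, coeffHom_normalOrdered, hiff,
        Finsupp.applyAddHom_apply, Finsupp.single_apply]
      split_ifs with h
      · simp [h]
      · simp
    have h := DFunLike.congr_fun key c
    rw [AddMonoidHom.comp_apply, hc, map_zero] at h
    exact (comp_iter_bijective hf (α 0)).1 (h.symm.trans (zero_comp).symm)
  · intro a
    refine mem_of_normalOrdered f (S := AddMonoidHom.mrange Φ) (fun i j g => ?_) a
    obtain ⟨r, hr⟩ := (comp_iter_bijective hf i).2 g
    refine ⟨Finsupp.single ![i, j] r, ?_⟩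
    rw [hsingle, ← hr]
    rfl

theorem x_mul_ofPoly (h : f'.comp f = X) (r : K[X]) :
    gen f x * ofPoly f r = ofPoly f (r.comp f') * gen f x := by
  rw [ofPoly_apply, ofPoly_apply, aeval_t_mul_x, comp_assoc, h, comp_X]

theorem compRingHom_bijective {f f' : K[X]} (h₁ : f.comp f' = X) (h₂ : f'.comp f = X) :
    Function.Bijective (compRingHom f) := by
  refine Function.bijective_iff_has_inverse.2 ⟨compRingHom f', fun g => ?_, fun g => ?_⟩
  · rw [coe_compRingHom_apply, coe_compRingHom_apply, comp_assoc, h₁, comp_X]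
  · rw [coe_compRingHom_apply, coe_compRingHom_apply, comp_assoc, h₂, comp_X]

/-- The relation `t x = x f(t)` twists coefficients in the wrong direction for left modules, so `x`
acts through the compositional inverse `f'`, and `y` through `f`. -/
theorem isSkewPBWAction_x_y (h₁ : f.comp f' = X) (h₂ : f'.comp f = X) :
    IsSkewPBWAction (ofPoly f) ![gen f x, gen f y] ![compRingHom f', compRingHom f] 0 where
  injective := Fin.forall_fin_two.2
    ⟨(compRingHom_bijective h₂ h₁).1, (compRingHom_bijective h₁ h₂).1⟩
  leibniz := by simp
  mul_eq := by
    refine Fin.forall_fin_two.2 ⟨fun r => ?_, fun r => ?_⟩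
    · simpa using x_mul_ofPoly h₂ r
    · simpa [ofPoly_apply] using y_mul_aeval_t f r

theorem commutesUpTo_x_y (i j : Fin 2) :
    CommutesUpTo (ofPoly f) ![gen f x, gen f y] i j 1 := by
  have h := y_mul_x_sub f
  have h' : gen f x * gen f y - gen f y * gen f x = gen f t - aeval (gen f t) f := by
    rw [← neg_sub, h, neg_sub]
  fin_cases i <;> fin_cases j
  · exact ⟨0, 0, by simp⟩
  · exact ⟨f - X, 0, by simp [ofPoly_apply, h]⟩
  · exact ⟨X - f, 0, by simp [ofPoly_apply, h']⟩
  · exact ⟨0, 0, by simp⟩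

theorem isSkewPBWExtension_ofPoly (hf : f.natDegree = 1) :
    IsSkewPBWExtension (ofPoly f) ![gen f x, gen f y] := by
  obtain ⟨f', h₁, h₂⟩ := exists_comp_inverse hf
  have hσ := isSkewPBWAction_x_y h₁ h₂
  exact
    { injective := ofPoly_injective
      basis := bijective_sum_ofPoly hf
      coeff := fun i r hr => ⟨_, (map_ne_zero_iff _ (hσ.injective i)).2 hr, 0, by
        rw [hσ.mul_eq]; simp⟩
      comm := fun i j => ⟨1, one_ne_zero, commutesUpTo_x_y i j⟩ }

theorem isBijectiveSkewPBW_ofPoly (hf : f.natDegree = 1) :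
    IsBijectiveSkewPBW (ofPoly f) ![gen f x, gen f y] := by
  obtain ⟨f', h₁, h₂⟩ := exists_comp_inverse hf
  exact ⟨⟨_, _, isSkewPBWAction_x_y h₁ h₂, Fin.forall_fin_two.2
    ⟨compRingHom_bijective h₂ h₁, compRingHom_bijective h₁ h₂⟩⟩,
    fun i j _ => ⟨1, isUnit_one, commutesUpTo_x_y i j⟩⟩

theorem isEndomorphismTypeSkewPBW_ofPoly (hf : f.natDegree = 1) :
    IsEndomorphismTypeSkewPBW (ofPoly f) ![gen f x, gen f y] := by
  obtain ⟨f', h₁, h₂⟩ := exists_comp_inverse hf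
  exact ⟨_, _, isSkewPBWAction_x_y h₁ h₂, fun _ => rfl⟩

end DegreeOne

/-! ### Generalized Heisenberg algebras as skew PBW extensions of the base field -/

theorem algebraMap_mul_stdMonomial (c : K) (α : Fin 3 → ℕ) :
    algebraMap K (GenHeisenberg f) c * stdMonomial ![gen f x, gen f t, gen f y] α =
      gen f x ^ α 0 * aeval (gen f t) (monomial (α 1) c) * gen f y ^ α 2 := by
  simp [stdMonomial, List.ofFn_succ, aeval_monomial, ← Algebra.smul_def, mul_assoc]

theorem bijective_sum_algebraMap (f : K[X]) :
    Function.Bijective fun c : (Fin 3 → ℕ) →₀ K =>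
      c.sum fun α r => algebraMap K (GenHeisenberg f) r *
        stdMonomial ![gen f x, gen f t, gen f y] α := by
  let Φ : ((Fin 3 → ℕ) →₀ K) →+ GenHeisenberg f := Finsupp.liftAddHom fun α =>
    (AddMonoidHom.mulRight (stdMonomial ![gen f x, gen f t, gen f y] α)).comp
      (algebraMap K (GenHeisenberg f) : K →+ _)
  have hsingle (α : Fin 3 → ℕ) (r : K) : Φ (Finsupp.single α r) =
      gen f x ^ α 0 * aeval (gen f t) (monomial (α 1) r) * gen f y ^ α 2 := by
    rw [← algebraMap_mul_stdMonomial]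
    exact Finsupp.liftAddHom_apply_single _ _ _
  change Function.Bijective Φ
  constructor
  · refine (injective_iff_map_eq_zero Φ).2 fun c hc => Finsupp.ext fun α => ?_
    have key : ((lcoeff K (α 1)).toAddMonoidHom.comp (coeffHom f (α 0, α 2))).comp Φ =
        Finsupp.applyAddHom α := by
      refine Finsupp.addHom_ext fun β r => ?_
      have hiff : β = α ↔ (β 0, β 2) = (α 0, α 2) ∧ β 1 = α 1 := by
        simp only [funext_iff, Fin.forall_fin_succ, Prod.mk.injEq]
        simp
        tauto
      simp only [AddMonoidHom.comp_apply, hsingle, coeffHom_normalOrdered, hiff,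
        Finsupp.applyAddHom_apply, Finsupp.single_apply]
      by_cases h : (β 0, β 2) = (α 0, α 2) <;> simp [h, coeff_monomial]
    have h := DFunLike.congr_fun key c
    rw [AddMonoidHom.comp_apply, hc, map_zero] at h
    exact h.symm
  · intro a
    refine mem_of_normalOrdered f (S := AddMonoidHom.mrange Φ) (fun i j g => ?_) a
    induction g using Polynomial.induction_on' with
    | add g h hg hh =>
      rw [map_add, mul_add, add_mul]
      exact add_mem hg hh
    | monomial k r => exact ⟨Finsupp.single ![i, k, j] r, hsingle _ _⟩

/-- These are the relations for `f = a t + b` with `u, w, v` in the roles of `x, t, y`. Reversing a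
pair that involves `w` requires `a⁻¹`. -/
theorem exists_smul_relation {A : Type*} [Ring A] [Algebra K A] {u v w : A} {a b : K}
    (ha : a ≠ 0) (hwu : w * u = a • (u * w) + b • u) (hvw : v * w = a • (w * v) + b • v)
    (hvu : v * u = a • w + b • 1 - w + u * v) (i j : Fin 3) :
    ∃ d : K, d ≠ 0 ∧ ∃ (r₀ : K) (r : Fin 3 → K),
      ![u, w, v] j * ![u, w, v] i - d • (![u, w, v] i * ![u, w, v] j) =
        r₀ • 1 + (r 0 • u + r 1 • w + r 2 • v) := by
  fin_cases i <;> fin_cases j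
  · exact ⟨1, one_ne_zero, 0, 0, by simp⟩
  · exact ⟨a, ha, 0, ![b, 0, 0], by simp [hwu]⟩
  · exact ⟨1, one_ne_zero, b, ![0, a - 1, 0], by simp [hvu, sub_smul]; abel⟩
  · exact ⟨a⁻¹, inv_ne_zero ha, 0, ![-(a⁻¹ * b), 0, 0], by simp [hwu, smul_smul, ha]⟩
  · exact ⟨1, one_ne_zero, 0, 0, by simp⟩
  · exact ⟨a, ha, 0, ![0, 0, b], by simp [hvw]⟩
  · exact ⟨1, one_ne_zero, -b, ![0, 1 - a, 0], by simp [hvu, sub_smul]; abel⟩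
  · exact ⟨a⁻¹, inv_ne_zero ha, 0, ![0, 0, -(a⁻¹ * b)], by simp [hvw, smul_smul, ha]⟩
  · exact ⟨1, one_ne_zero, 0, 0, by simp⟩

theorem isSkewPBWExtension_algebraMap (hf : f.natDegree = 1) :
    IsSkewPBWExtension (algebraMap K (GenHeisenberg f)) ![gen f x, gen f t, gen f y] where
  injective := algebraMap_injective
  basis := bijective_sum_algebraMap f
  coeff i r hr := ⟨r, hr, 0, by rw [← Algebra.commutes, sub_self, map_zero]⟩
  comm i j := by
    obtain ⟨a, ha, b, rfl⟩ := natDegree_eq_one.1 hf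
    have htx := t_mul_x (C a * X + C b)
    have hyt := y_mul_t (C a * X + C b)
    have hyx := sub_eq_iff_eq_add.1 (y_mul_x_sub (C a * X + C b))
    simp only [map_add, map_mul, aeval_C, aeval_X, Algebra.algebraMap_eq_smul_one,
      mul_add, add_mul, mul_smul_comm, smul_mul_assoc, mul_one, one_mul] at htx hyt hyx
    obtain ⟨d, hd, r₀, r, h⟩ := exists_smul_relation ha htx hyt hyx i j
    refine ⟨d, hd, r₀, r, ?_⟩
    simpa [Fin.sum_univ_three, Algebra.smul_def] using h

end GenHeisenberg

theorem mainTheorem5 {K : Type*} [Field K] (f : Polynomial K) :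
    List.TFAE [
      ∃ (n : ℕ) (x : Fin n → GenHeisenberg f),
        IsSkewPBWExtension (GenHeisenberg.ofPoly f) x ∧
        IsBijectiveSkewPBW (GenHeisenberg.ofPoly f) x ∧
        IsEndomorphismTypeSkewPBW (GenHeisenberg.ofPoly f) x,
      ∃ (n : ℕ) (x : Fin n → GenHeisenberg f),
        IsSkewPBWExtension (algebraMap K (GenHeisenberg f)) x,
      IsNoetherianRing (GenHeisenberg f) ∨ IsNoetherianRing (GenHeisenberg f)ᵐᵒᵖ,
      IsNoetherianRing (GenHeisenberg f) ∧ IsNoetherianRing (GenHeisenberg f)ᵐᵒᵖ,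
      f.degree = 1] := by
  obtain ⟨e⟩ := GenHeisenberg.nonempty_ringEquiv_op f
  have hdeg : f.degree = 1 ↔ f.natDegree = 1 := by
    exact_mod_cast Polynomial.degree_eq_iff_natDegree_eq_of_pos (p := f) one_pos
  rw [hdeg]
  tfae_have 1 → 5
  | ⟨_, _, h, hb, he⟩ => GenHeisenberg.natDegree_eq_one_of_isSkewPBWExtension h hb he
  tfae_have 5 → 1 := fun h => ⟨2, _, GenHeisenberg.isSkewPBWExtension_ofPoly h,
    GenHeisenberg.isBijectiveSkewPBW_ofPoly h, GenHeisenberg.isEndomorphismTypeSkewPBW_ofPoly h⟩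
  tfae_have 5 → 2 := fun h => ⟨3, _, GenHeisenberg.isSkewPBWExtension_algebraMap h⟩
  tfae_have 2 → 4
  | ⟨_, _, h⟩ =>
    have := h.isNoetherianRing
    ⟨this, isNoetherianRing_of_ringEquiv _ e⟩
  tfae_have 4 → 3 := fun h => Or.inl h.1
  tfae_have 3 → 5
  | .inl h => GenHeisenberg.natDegree_eq_one_of_isNoetherianRing h
  | .inr _ => GenHeisenberg.natDegree_eq_one_of_isNoetherianRing
      (isNoetherianRing_of_ringEquiv _ e.symm)
  tfae_finish
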